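/- **Theorem.** Let $n\in\mathbb N$ and $\lambda\in\mathbb R\setminus\{0\}$. Write points of $\mathbb R^{2n}$ as $\xi=(x,u)$ with $x,u\in\mathbb R^n$, put $[(x,u),(y,v)]=u\cdot y-v\cdot x$, and extend this form and the dot product complex-bilinearly to $\mathbb C^{2n}$. For a Schwartz function $g\in\mathcal S(\mathbb R^{2n})$ define the twisted translations, the twisted modulations and the operators $\Pi_\lambda$, $U_\lambda$ by $$\tau_\lambda(\eta)g(\xi)=g(\xi-\eta)\,e^{-i\frac{\lambda}{2}[\xi,\eta]},$$ $$e_\lambda(a,b)g(x,u)=g\big(x-(\tanh\tfrac{\lambda}{2})\,b,\;u+(\tanh\tfrac{\lambda}{2})\,a\big)\,e^{-i\frac{\lambda}{2}(\coth\frac{\lambda}{2})(x\cdot a+u\cdot b)},$$ $$\Pi_\lambda(\xi,\eta)=e^{i\frac{\lambda}{2}(\coth\lambda)\,\xi\cdot\eta}\,e_\lambda(\eta)\,\tau_\lambda(\xi),\qquad U_\lambda g(\xi)=c(\lambda)^n\,\widehat g(c(\lambda)\xi),\quad c(\lambda)=\tfrac{\lambda}{2}\coth\tfrac{\lambda}{2},$$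 where $\widehat g(\omega)=(2\pi)^{-n}\int_{\mathbb R^{2n}}e^{-iy\cdot\omega}g(y)\,dy$. Let $\langle f,g\rangle$ be the sesquilinear pairing of a tempered distribution $f$ with a Schwartz function $g$ that extends $\int f\bar g$. The operators are extended to tempered distributions by duality, $\langle Tf,g\rangle=\langle f,T^*g\rangle$, where $\tau_\lambda(\xi)^*=\tau_\lambda(-\xi)$, $e_\lambda(\eta)^*=e_\lambda(-\eta)$ and $U_\lambda^*g(\xi)=c(\lambda)^n(2\pi)^{-n}\int e^{i c(\lambda)y\cdot\xi}g(y)\,dy$. For $1\le p,q\le\infty$ let $M_\lambda^{p,q}(\mathbb R^{2n})$ be the set of tempered distributions $f$ on $\mathbb R^{2n}$ for which there is a non-zero $g\in\mathcal S(\mathbb R^{2n})$ such that $(\xi,\eta)\mapsto\langle f,\Pi_\lambda(\xi,\eta)g\rangle$ belongs to the mixed norm space $L^{p,q}(\mathbb R^{2n}\times\mathbb R^{2n})$ ($L^p$ norm in $\xi$ first, then $L^q$ norm in $\eta$). Then: 1. The operators are those transported from the twisted Fock space by the twisted Bargmann transform. Let $p_t^\lambda(\zeta)=(4\pi)^{-n}\lambda^n(\sinh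 t\lambda)^{-n}e^{-\frac{\lambda}{4}(\coth t\lambda)\,\zeta\cdot\zeta}$ and $c_\lambda=(4\pi)^{-n}\lambda^n(\sinh\lambda)^{-n}$, and for $\zeta\in\mathbb C^{2n}$ let $$B_\lambda g(\zeta)=c_\lambda\,p_1^\lambda(\zeta)^{-1}\int_{\mathbb R^{2n}}g(\eta)\,p_{1/2}^\lambda(\zeta-\eta)\,e^{-i\frac{\lambda}{2}[\zeta,\eta]}\,d\eta,$$ $$\rho_\lambda(\zeta')F(\zeta)=F(\zeta-\zeta')\,e^{\frac{\lambda}{2}(\coth\lambda)\,\zeta\cdot\overline{\zeta'}}\,e^{-i\frac{\lambda}{2}[\zeta,\overline{\zeta'}]}\,e^{-\frac{\lambda}{4}(\coth\lambda)|\zeta'|^2}\,e^{\frac{\lambda}{2}[\Re\zeta',\Im\zeta']}.$$ For all $\xi,\eta\in\mathbb R^{2n}$, $\zeta\in\mathbb C^{2n}$ and $g\in\mathcal S(\mathbb R^{2n})$ one has $B_\lambda(\Pi_\lambda(\xi,\eta)g)=\rho_\lambda(\xi+i\eta)(B_\lambda g)$ and $B_\lambda(U_\lambda g)(\zeta)=B_\lambda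 g(-i\zeta)$. 2. For all $1\le p,q\le\infty$, $M_\lambda^{p,q}(\mathbb R^{2n})$ is invariant under $\tau_\lambda(\xi)$ and under $e_\lambda(\eta)$ for all $\xi,\eta\in\mathbb R^{2n}$. 3. $U_\lambda\,\Pi_\lambda(\xi,\eta)\,U_\lambda^*=\Pi_\lambda(-\eta,\xi)$ on tempered distributions (in particular on $L^2(\mathbb R^{2n})$) for all $\xi,\eta\in\mathbb R^{2n}$. 4. For all $1\le p\le\infty$, $M_\lambda^{p,p}(\mathbb R^{2n})$ is invariant under $U_\lambda$. -/

import Mathlib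

open MeasureTheory
open scoped SchwartzMap FourierTransform ENNReal ComplexConjugate

noncomputable section

namespace TwistedMod

/-! ### The spaces `ℝ²ⁿ` and `ℂ²ⁿ`

A point of `ℝ²ⁿ = ℝⁿ × ℝⁿ` is written `ξ = (x, u)`; `x` has the indices `Sum.inl i` and `u` the
indices `Sum.inr i`. -/

/-- `ℝ²ⁿ` with its Euclidean structure. -/
abbrev RR (n : ℕ) := EuclideanSpace ℝ (Fin n ⊕ Fin n)

/-- `ℂ²ⁿ`. -/
abbrev CC (n : ℕ) := EuclideanSpace ℂ (Fin n ⊕ Fin n)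

/-- The symplectic form `[(x,u),(y,v)] = u·y - v·x` on `ℝ²ⁿ`. -/
def symp {n : ℕ} (ξ η : RR n) : ℝ :=
  ∑ i : Fin n, (ξ (Sum.inr i) * η (Sum.inl i) - η (Sum.inr i) * ξ (Sum.inl i))

/-- The complex bilinear extension of the symplectic form to `ℂ²ⁿ`. -/
def csymp {n : ℕ} (ζ ζ' : CC n) : ℂ :=
  ∑ i : Fin n, (ζ (Sum.inr i) * ζ' (Sum.inl i) - ζ' (Sum.inr i) * ζ (Sum.inl i))

/-- The complex bilinear dot product `ζ·ζ'` on `ℂ²ⁿ` (no conjugation). -/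
def cdot {n : ℕ} (ζ ζ' : CC n) : ℂ := ∑ j, ζ j * ζ' j

/-- The matrix `J = (0, I; -I, 0)`: `J (a,b) = (b,-a)`. -/
def rotJ {n : ℕ} (ξ : RR n) : RR n :=
  WithLp.toLp 2 (Sum.elim (fun i => ξ (Sum.inr i)) (fun i => -ξ (Sum.inl i)))

/-- The inclusion `ℝ²ⁿ ⊆ ℂ²ⁿ`. -/
def toCC {n : ℕ} (ξ : RR n) : CC n := WithLp.toLp 2 (fun j => (ξ j : ℂ))

/-- The coordinatewise conjugate of `ζ`. -/
def conjCC {n : ℕ} (ζ : CC n) : CC n := WithLp.toLp 2 (fun j => conj (ζ j))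

/-- The coordinatewise real part of `ζ`. -/
def reCC {n : ℕ} (ζ : CC n) : RR n := WithLp.toLp 2 (fun j => (ζ j).re)

/-- The coordinatewise imaginary part of `ζ`. -/
def imCC {n : ℕ} (ζ : CC n) : RR n := WithLp.toLp 2 (fun j => (ζ j).im)

/-- The hyperbolic cotangent (used only at non-zero arguments). -/
def coth (s : ℝ) : ℝ := Real.cosh s / Real.sinh s

/-- `c(λ) = (λ/2) coth(λ/2)`. -/
def cFun (lam : ℝ) : ℝ := lam / 2 * coth (lam / 2)

theorem cFun_pos {lam : ℝ} (h : lam ≠ 0) : 0 < cFun lam := by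
  have hx : lam / 2 ≠ 0 := by positivity
  unfold cFun coth
  generalize lam / 2 = x at hx
  have hc := Real.cosh_pos x
  have key : 0 < x / Real.sinh x := by
    rcases lt_or_gt_of_ne hx with h1 | h1
    · exact div_pos_of_neg_of_neg h1 (Real.sinh_neg_iff.mpr h1)
    · exact div_pos h1 (Real.sinh_pos_iff.mpr h1)
  have e : x * (Real.cosh x / Real.sinh x) = Real.cosh x * (x / Real.sinh x) := by ring
  rw [e]
  positivity

/-! ### Operators on Schwartz functions -/

theorem hasTemperateGrowth_cexp {n : ℕ} (L : RR n →L[ℝ] ℝ) :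
    (fun x : RR n => Complex.exp (Complex.I * (L x : ℂ))).HasTemperateGrowth := by
  have h1 : (fun t : ℝ => Complex.exp (Complex.I * (t : ℂ))).HasTemperateGrowth := by
    have hd : ∀ m : ℕ, iteratedDeriv m (fun t : ℝ => Complex.exp (Complex.I * (t : ℂ)))
        = fun t : ℝ => Complex.I ^ m * Complex.exp (Complex.I * (t : ℂ)) := by
      intro m
      induction m with
      | zero => simp
      | succ k ih =>
        rw [iteratedDeriv_succ, ih]
        funext t
        have h0 : HasDerivAt (fun t : ℝ => Complex.I * (t : ℂ)) (Complex.I * 1) t :=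
          (Complex.ofRealCLM.hasDerivAt (x := t)).const_mul Complex.I
        have h2 := (h0.cexp).const_mul (Complex.I ^ k)
        rw [h2.deriv]
        ring
    refine ⟨(contDiff_const.mul Complex.ofRealCLM.contDiff).cexp, fun m => ⟨0, 1, fun t => ?_⟩⟩
    rw [norm_iteratedFDeriv_eq_norm_iteratedDeriv, hd]
    simp [Complex.norm_exp]
  exact h1.comp L.hasTemperateGrowth

/-- `x ↦ [x, ξ]` as a continuous linear functional. -/
def sympCLM {n : ℕ} (ξ : RR n) : RR n →L[ℝ] ℝ :=
  LinearMap.toContinuousLinearMap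
    { toFun := fun x => symp x ξ
      map_add' := fun x y => by
        simp only [symp, PiLp.add_apply, ← Finset.sum_add_distrib]
        exact Finset.sum_congr rfl fun i _ => by ring
      map_smul' := fun r x => by
        simp only [symp, PiLp.smul_apply, smul_eq_mul, RingHom.id_apply, Finset.mul_sum]
        exact Finset.sum_congr rfl fun i _ => by ring }

/-- The twisted translation `(τ_λ(ξ) g)(x) = g(x - ξ) exp(-i(λ/2)[x,ξ])` on Schwartz functions. -/
def twTrans {n : ℕ} (lam : ℝ) (ξ : RR n) : 𝓢(RR n, ℂ) →L[ℂ] 𝓢(RR n, ℂ) :=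
  SchwartzMap.smulLeftCLM ℂ 
      (fun x : RR n => Complex.exp (Complex.I * ((-(lam / 2) * symp x ξ : ℝ) : ℂ)))
    ∘L SchwartzMap.compSubConstCLM ℂ ξ

theorem twTrans_growth {n : ℕ} (lam : ℝ) (ξ : RR n) :
    (fun x : RR n => Complex.exp
      (Complex.I * ((-(lam / 2) * symp x ξ : ℝ) : ℂ))).HasTemperateGrowth :=
  hasTemperateGrowth_cexp ((-(lam / 2)) • sympCLM ξ)

theorem twTrans_apply {n : ℕ} (lam : ℝ) (ξ : RR n) (g : 𝓢(RR n, ℂ)) (x : RR n) :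
    twTrans lam ξ g x
      = Complex.exp (Complex.I * ((-(lam / 2) * symp x ξ : ℝ) : ℂ)) * g (x - ξ) := by
  simp only [twTrans, ContinuousLinearMap.comp_apply]
  rw [SchwartzMap.smulLeftCLM_apply_apply (twTrans_growth lam ξ)]
  rfl

/-- The twisted modulation
`(e_λ(a,b) g)(x,u) = g(x - tanh(λ/2) b, u + tanh(λ/2) a) exp(-i(λ/2) coth(λ/2) (x·a + u·b))`
on Schwartz functions. -/
def twMod {n : ℕ} (lam : ℝ) (η : RR n) : 𝓢(RR n, ℂ) →L[ℂ] 𝓢(RR n, ℂ) :=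
  SchwartzMap.smulLeftCLM ℂ
      (fun x : RR n => Complex.exp
        (Complex.I * ((-(lam / 2 * coth (lam / 2)) * inner ℝ η x : ℝ) : ℂ)))
    ∘L SchwartzMap.compSubConstCLM ℂ (Real.tanh (lam / 2) • rotJ η)

theorem twMod_growth {n : ℕ} (lam : ℝ) (η : RR n) :
    (fun x : RR n => Complex.exp
      (Complex.I * ((-(lam / 2 * coth (lam / 2)) * inner ℝ η x : ℝ) : ℂ))).HasTemperateGrowth :=
  hasTemperateGrowth_cexp ((-(lam / 2 * coth (lam / 2))) • innerSL ℝ η)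

theorem twMod_apply {n : ℕ} (lam : ℝ) (η : RR n) (g : 𝓢(RR n, ℂ)) (x : RR n) :
    twMod lam η g x
      = Complex.exp (Complex.I * ((-(lam / 2 * coth (lam / 2)) * inner ℝ η x : ℝ) : ℂ))
        * g (x - Real.tanh (lam / 2) • rotJ η) := by
  simp only [twMod, ContinuousLinearMap.comp_apply]
  rw [SchwartzMap.smulLeftCLM_apply_apply (twMod_growth lam η)]
  rfl

/-- `Π_λ(ξ,η) = exp(i(λ/2)(coth λ) ξ·η) e_λ(η) τ_λ(ξ)` on Schwartz functions. -/
def twPi {n : ℕ} (lam : ℝ) (ξ η : RR n) : 𝓢(RR n, ℂ) →L[ℂ] 𝓢(RR n, ℂ) :=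
  Complex.exp (Complex.I * ((lam / 2 * coth lam * inner ℝ ξ η : ℝ) : ℂ)) •
    (twMod lam η ∘L twTrans lam ξ)

/-- The factor `c(λ) / (2π)` as a non-zero real number. -/
def scale (lam : ℝ) (h : lam ≠ 0) : ℝˣ :=
  Units.mk0 (cFun lam / (2 * Real.pi)) (div_pos (cFun_pos h) (by positivity)).ne'

/-- The operator `(U_λ g)(x) = c(λ)ⁿ ĝ(c(λ) x)` on Schwartz functions, where
`ĝ(ω) = (2π)⁻ⁿ ∫ exp(-i y·ω) g(y) dy` is the unitary Fourier transform on `ℝ²ⁿ`;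
Mathlib's `𝓕` has the kernel `exp(-2πi y·ω)`. -/
def twU {n : ℕ} (lam : ℝ) (h : lam ≠ 0) : 𝓢(RR n, ℂ) →L[ℂ] 𝓢(RR n, ℂ) :=
  (((cFun lam ^ n * ((2 * Real.pi) ^ n)⁻¹ : ℝ) : ℂ)) •
    (SchwartzMap.compCLMOfContinuousLinearEquiv ℂ
        (ContinuousLinearEquiv.smulLeft (M₁ := RR n) (R₁ := ℝ) (scale lam h))
      ∘L FourierTransform.fourierCLM ℂ 𝓢(RR n, ℂ))

/-- The adjoint `(U_λ* g)(x) = c(λ)ⁿ ǧ(c(λ) x)` of `U_λ` on Schwartz functions, where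
`ǧ(ω) = (2π)⁻ⁿ ∫ exp(i y·ω) g(y) dy`. -/
def twUadj {n : ℕ} (lam : ℝ) (h : lam ≠ 0) : 𝓢(RR n, ℂ) →L[ℂ] 𝓢(RR n, ℂ) :=
  (((cFun lam ^ n * ((2 * Real.pi) ^ n)⁻¹ : ℝ) : ℂ)) •
    (SchwartzMap.compCLMOfContinuousLinearEquiv ℂ
        (ContinuousLinearEquiv.smulLeft (M₁ := RR n) (R₁ := ℝ) (scale lam h))
      ∘L FourierTransform.fourierInvCLM ℂ 𝓢(RR n, ℂ))

theorem twU_apply {n : ℕ} (lam : ℝ) (h : lam ≠ 0) (g : 𝓢(RR n, ℂ)) (x : RR n) :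
    twU lam h g x = (cFun lam : ℂ) ^ n * (((2 * Real.pi : ℝ) : ℂ) ^ n)⁻¹ *
      ∫ y : RR n, Complex.exp (-(Complex.I * ((inner ℝ y (cFun lam • x) : ℝ) : ℂ))) * g y := by
  have e : twU lam h g x = (((cFun lam ^ n * ((2 * Real.pi) ^ n)⁻¹ : ℝ) : ℂ)) *
      𝓕 (g : RR n → ℂ) ((cFun lam / (2 * Real.pi)) • x) := rfl
  rw [e, Real.fourier_eq']
  congr 1
  · push_cast
    rfl
  · refine integral_congr_ae (Filter.Eventually.of_forall fun y => ?_)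
    simp only [smul_eq_mul]
    congr 2
    rw [inner_smul_right, inner_smul_right]
    push_cast
    have : (Real.pi : ℂ) ≠ 0 := by exact_mod_cast Real.pi_ne_zero
    field_simp

theorem twUadj_apply {n : ℕ} (lam : ℝ) (h : lam ≠ 0) (g : 𝓢(RR n, ℂ)) (x : RR n) :
    twUadj lam h g x = (cFun lam : ℂ) ^ n * (((2 * Real.pi : ℝ) : ℂ) ^ n)⁻¹ *
      ∫ y : RR n, Complex.exp (Complex.I * ((inner ℝ y (cFun lam • x) : ℝ) : ℂ)) * g y := by
  have e : twUadj lam h g x = (((cFun lam ^ n * ((2 * Real.pi) ^ n)⁻¹ : ℝ) : ℂ)) *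
      (𝓕⁻ g) ((cFun lam / (2 * Real.pi)) • x) := rfl
  rw [e, SchwartzMap.fourierInv_coe, Real.fourierInv_eq']
  congr 1
  · push_cast
    rfl
  · refine integral_congr_ae (Filter.Eventually.of_forall fun y => ?_)
    simp only [smul_eq_mul]
    congr 2
    rw [inner_smul_right, inner_smul_right]
    push_cast
    have : (Real.pi : ℂ) ≠ 0 := by exact_mod_cast Real.pi_ne_zero
    field_simp

/-! ### Operators on tempered distributions

For a tempered distribution `f` and a Schwartz function `g`, the pairing `⟨f, g⟩` extends the
inner product `∫ f conj(g)` of `L²(ℝ²ⁿ)`.  An operator `T` is extended to tempered distributions by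
duality: `⟨T f, g⟩ = ⟨f, T* g⟩`. -/

/-- The complex conjugate of a Schwartz function. -/
def conjS {n : ℕ} : 𝓢(RR n, ℂ) →L[ℝ] 𝓢(RR n, ℂ) :=
  SchwartzMap.postcompCLM (Complex.conjCLE : ℂ →L[ℝ] ℂ)

theorem conjS_apply {n : ℕ} (g : 𝓢(RR n, ℂ)) (x : RR n) : conjS g x = conj (g x) := rfl

theorem conjS_conjS {n : ℕ} (g : 𝓢(RR n, ℂ)) : conjS (conjS g) = g := by
  ext x
  simp [conjS_apply]

theorem conjS_smul {n : ℕ} (c : ℂ) (g : 𝓢(RR n, ℂ)) : conjS (c • g) = conj c • conjS g := by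
  ext x
  simp [conjS_apply]

/-- The sesquilinear pairing `⟨f, g⟩ = f(conj g)`. -/
def pair {n : ℕ} (f : 𝓢'(RR n, ℂ)) (g : 𝓢(RR n, ℂ)) : ℂ := f (conjS g)

theorem pair_toTempered {n : ℕ} (f g : 𝓢(RR n, ℂ)) :
    pair (SchwartzMap.toTemperedDistributionCLM (RR n) ℂ volume f) g = ∫ x, f x * conj (g x) := by
  simp [pair, conjS_apply, mul_comm]

/-- The operator `g ↦ conj(A(conj g))`. -/
def conjOp {n : ℕ} (A : 𝓢(RR n, ℂ) →L[ℂ] 𝓢(RR n, ℂ)) : 𝓢(RR n, ℂ) →L[ℂ] 𝓢(RR n, ℂ) where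
  toFun g := conjS (A (conjS g))
  map_add' g h := by simp
  map_smul' c g := by simp [conjS_smul]
  cont := conjS.continuous.comp (A.continuous.comp conjS.continuous)

/-- The operator `f ↦ (g ↦ ⟨f, A g⟩)` on tempered distributions: it extends the operator whose
`L²`-adjoint is `A`. -/
def dualExt {n : ℕ} (A : 𝓢(RR n, ℂ) →L[ℂ] 𝓢(RR n, ℂ)) : 𝓢'(RR n, ℂ) →L[ℂ] 𝓢'(RR n, ℂ) :=
  PointwiseConvergenceCLM.precomp ℂ (conjOp A)

theorem pair_dualExt {n : ℕ} (A : 𝓢(RR n, ℂ) →L[ℂ] 𝓢(RR n, ℂ)) (f : 𝓢'(RR n, ℂ))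
    (g : 𝓢(RR n, ℂ)) : pair (dualExt A f) g = pair f (A g) := by
  change f (conjS (A (conjS (conjS g)))) = _
  rw [conjS_conjS]
  rfl

/-- The twisted translation `τ_λ(ξ)` on tempered distributions; its adjoint is `τ_λ(-ξ)`. -/
def twTransD {n : ℕ} (lam : ℝ) (ξ : RR n) : 𝓢'(RR n, ℂ) →L[ℂ] 𝓢'(RR n, ℂ) :=
  dualExt (twTrans lam (-ξ))

/-- The twisted modulation `e_λ(η)` on tempered distributions; its adjoint is `e_λ(-η)`. -/
def twModD {n : ℕ} (lam : ℝ) (η : RR n) : 𝓢'(RR n, ℂ) →L[ℂ] 𝓢'(RR n, ℂ) :=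
  dualExt (twMod lam (-η))

/-- `Π_λ(ξ,η) = exp(i(λ/2)(coth λ) ξ·η) e_λ(η) τ_λ(ξ)` on tempered distributions. -/
def twPiD {n : ℕ} (lam : ℝ) (ξ η : RR n) : 𝓢'(RR n, ℂ) →L[ℂ] 𝓢'(RR n, ℂ) :=
  Complex.exp (Complex.I * ((lam / 2 * coth lam * inner ℝ ξ η : ℝ) : ℂ)) •
    (twModD lam η ∘L twTransD lam ξ)

/-- The operator `U_λ` on tempered distributions. -/
def twUD {n : ℕ} (lam : ℝ) (h : lam ≠ 0) : 𝓢'(RR n, ℂ) →L[ℂ] 𝓢'(RR n, ℂ) :=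
  dualExt (twUadj lam h)

/-- The operator `U_λ*` on tempered distributions. -/
def twUadjD {n : ℕ} (lam : ℝ) (h : lam ≠ 0) : 𝓢'(RR n, ℂ) →L[ℂ] 𝓢'(RR n, ℂ) :=
  dualExt (twU lam h)

/-! The operators on tempered distributions extend those on Schwartz functions. -/

theorem dualExt_toTempered {n : ℕ} {A B : 𝓢(RR n, ℂ) →L[ℂ] 𝓢(RR n, ℂ)} {g : 𝓢(RR n, ℂ)}
    (hAB : ∀ k : 𝓢(RR n, ℂ), ∫ x, A g x * conj (k x) = ∫ x, g x * conj (B k x)) :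
    dualExt B (SchwartzMap.toTemperedDistributionCLM (RR n) ℂ volume g)
      = SchwartzMap.toTemperedDistributionCLM (RR n) ℂ volume (A g) := by
  ext k
  have h1 := pair_dualExt B (SchwartzMap.toTemperedDistributionCLM (RR n) ℂ volume g) (conjS k)
  have h2 := hAB (conjS k)
  rw [pair_toTempered, ← h2, ← pair_toTempered] at h1
  simpa [pair, conjS_conjS] using h1

theorem symp_self {n : ℕ} (ξ : RR n) : symp ξ ξ = 0 := by simp [symp]

theorem symp_neg {n : ℕ} (x ξ : RR n) : symp x (-ξ) = -symp x ξ := by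
  simp only [symp, PiLp.neg_apply, ← Finset.sum_neg_distrib]
  exact Finset.sum_congr rfl fun i _ => by ring

theorem symp_add_left {n : ℕ} (x y ξ : RR n) : symp (x + y) ξ = symp x ξ + symp y ξ :=
  (sympCLM ξ).map_add x y

theorem rotJ_neg {n : ℕ} (ξ : RR n) : rotJ (-ξ) = -rotJ ξ := by
  ext j
  cases j <;> simp [rotJ]

theorem inner_rotJ {n : ℕ} (ξ : RR n) : inner ℝ ξ (rotJ ξ) = 0 := by
  simp [PiLp.inner_apply, rotJ, mul_comm]

theorem conj_cexp_I (t : ℝ) :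
    conj (Complex.exp (Complex.I * (t : ℂ))) = Complex.exp (Complex.I * ((-t : ℝ) : ℂ)) := by
  rw [← Complex.exp_conj]
  simp

theorem twTransD_toTempered {n : ℕ} (lam : ℝ) (ξ : RR n) (g : 𝓢(RR n, ℂ)) :
    twTransD lam ξ (SchwartzMap.toTemperedDistributionCLM (RR n) ℂ volume g)
      = SchwartzMap.toTemperedDistributionCLM (RR n) ℂ volume (twTrans lam ξ g) := by
  refine dualExt_toTempered fun k => ?_
  rw [← integral_add_right_eq_self _ ξ]
  refine integral_congr_ae (Filter.Eventually.of_forall fun x => ?_)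
  simp only [twTrans_apply, map_mul, conj_cexp_I, symp_neg, symp_add_left, symp_self,
    add_sub_cancel_right, sub_neg_eq_add]
  rw [show -(lam / 2) * (symp x ξ + 0) = -(-(lam / 2) * -symp x ξ) by ring]
  ring

theorem twModD_toTempered {n : ℕ} (lam : ℝ) (η : RR n) (g : 𝓢(RR n, ℂ)) :
    twModD lam η (SchwartzMap.toTemperedDistributionCLM (RR n) ℂ volume g)
      = SchwartzMap.toTemperedDistributionCLM (RR n) ℂ volume (twMod lam η g) := by
  refine dualExt_toTempered fun k => ?_
  rw [← integral_add_right_eq_self _ (Real.tanh (lam / 2) • rotJ η)]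
  refine integral_congr_ae (Filter.Eventually.of_forall fun x => ?_)
  simp only [twMod_apply, map_mul, conj_cexp_I, rotJ_neg, inner_add_right, inner_neg_left,
    inner_smul_right, inner_rotJ, add_sub_cancel_right, smul_neg, sub_neg_eq_add, mul_zero,
    add_zero]
  rw [show -(lam / 2 * coth (lam / 2)) * inner ℝ η x
    = -(-(lam / 2 * coth (lam / 2)) * -inner ℝ η x) by ring]
  ring

theorem twU_adjoint {n : ℕ} (lam : ℝ) (h : lam ≠ 0) (g k : 𝓢(RR n, ℂ)) :
    ∫ x, twU lam h g x * conj (k x) = ∫ x, g x * conj (twUadj lam h k x) := by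
  set r : ℝ := cFun lam / (2 * Real.pi) with hr
  let L : RR n →ₗ[ℝ] RR n →ₗ[ℝ] ℝ := r • innerₗ (RR n)
  have hL : Continuous fun p : RR n × RR n => L p.1 p.2 := by
    change Continuous fun p : RR n × RR n => r * inner ℝ p.1 p.2
    fun_prop
  have hk : Integrable (fun x => conj (k x)) := (conjS k).integrable
  have main := VectorFourier.integral_bilin_fourierIntegral_eq_flip (μ := volume) (ν := volume)
    (ContinuousLinearMap.mul ℂ ℂ) Real.continuous_fourierChar hL g.integrable hk
  have e1 : ∀ x, twU lam h g x = (((cFun lam ^ n * ((2 * Real.pi) ^ n)⁻¹ : ℝ) : ℂ)) *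
      VectorFourier.fourierIntegral Real.fourierChar volume L g x := by
    intro x
    have e : twU lam h g x = (((cFun lam ^ n * ((2 * Real.pi) ^ n)⁻¹ : ℝ) : ℂ)) *
      𝓕 (g : RR n → ℂ) (r • x) := rfl
    rw [e, Real.fourier_eq, VectorFourier.fourierIntegral]
    congr 1
    refine integral_congr_ae (Filter.Eventually.of_forall fun y => ?_)
    simp only [inner_smul_right]
    rfl
  have e2 : ∀ x, conj (twUadj lam h k x) = (((cFun lam ^ n * ((2 * Real.pi) ^ n)⁻¹ : ℝ) : ℂ)) *
      VectorFourier.fourierIntegral Real.fourierChar volume L.flip (fun x => conj (k x)) x := by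
    intro x
    have e : twUadj lam h k x = (((cFun lam ^ n * ((2 * Real.pi) ^ n)⁻¹ : ℝ) : ℂ)) *
      (𝓕⁻ k) (r • x) := rfl
    rw [e, SchwartzMap.fourierInv_coe, Real.fourierInv_eq, VectorFourier.fourierIntegral, map_mul,
      Complex.conj_ofReal, ← integral_conj]
    congr 1
    refine integral_congr_ae (Filter.Eventually.of_forall fun y => ?_)
    have hy : L.flip y x = r * inner ℝ x y := rfl
    simp only [hy, inner_smul_right, Circle.smul_def, smul_eq_mul, map_mul,
      real_inner_comm x y, AddChar.map_neg_eq_inv, Circle.coe_inv_eq_conj]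
  simp only [e1, e2]
  simp only [ContinuousLinearMap.mul_apply'] at main
  simp only [mul_assoc, integral_const_mul, main]
  rw [← integral_const_mul]
  refine integral_congr_ae (Filter.Eventually.of_forall fun y => ?_)
  simp only
  ring

theorem twUD_toTempered {n : ℕ} (lam : ℝ) (h : lam ≠ 0) (g : 𝓢(RR n, ℂ)) :
    twUD lam h (SchwartzMap.toTemperedDistributionCLM (RR n) ℂ volume g)
      = SchwartzMap.toTemperedDistributionCLM (RR n) ℂ volume (twU lam h g) :=
  dualExt_toTempered (twU_adjoint lam h g)

/-! ### The twisted Bargmann transform and the representation on the twisted Fock space -/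

/-- The holomorphic extension to `ℂ²ⁿ` of the heat kernel
`p_t^λ(ξ) = (4π)⁻ⁿ λⁿ (sinh tλ)⁻ⁿ exp(-(λ/4) coth(tλ) |ξ|²)` of the special Hermite operator. -/
def heatKernel {n : ℕ} (lam t : ℝ) (ζ : CC n) : ℂ :=
  (((4 * Real.pi) ^ n)⁻¹ * lam ^ n * (Real.sinh (t * lam) ^ n)⁻¹ : ℝ) *
    Complex.exp (-((lam / 4 * coth (t * lam) : ℝ) : ℂ) * cdot ζ ζ)

/-- `c_λ = (4π)⁻ⁿ λⁿ (sinh λ)⁻ⁿ`. -/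
def cConst (n : ℕ) (lam : ℝ) : ℝ :=
  ((4 * Real.pi) ^ n)⁻¹ * lam ^ n * (Real.sinh lam ^ n)⁻¹

/-- The twisted Bargmann transform `B_λ g(ζ) = c_λ p_1^λ(ζ)⁻¹ (g *_λ p_{1/2}^λ)(ζ)`, where
`(g *_λ p)(ζ) = ∫ g(η) p(ζ - η) exp(-i(λ/2)[ζ,η]) dη` is the twisted convolution, extended
holomorphically to `ℂ²ⁿ`. -/
def bargmann {n : ℕ} (lam : ℝ) (g : RR n → ℂ) (ζ : CC n) : ℂ :=
  (cConst n lam : ℂ) * (heatKernel lam 1 ζ)⁻¹ *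
    ∫ η : RR n, g η * heatKernel lam (1 / 2) (ζ - toCC η) *
      Complex.exp (-(Complex.I * (lam / 2 : ℝ)) * csymp ζ (toCC η))

/-- The operator `ρ_λ(ζ')` of the twisted Fock space:
`ρ_λ(ζ')F(ζ) = F(ζ-ζ') exp((λ/2)(coth λ) ζ·conj ζ') exp(-i(λ/2)[ζ, conj ζ'])
  exp(-(λ/4)(coth λ)|ζ'|²) exp((λ/2)[Re ζ', Im ζ'])`. -/
def fockRep {n : ℕ} (lam : ℝ) (ζ' : CC n) (F : CC n → ℂ) (ζ : CC n) : ℂ :=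
  F (ζ - ζ') * Complex.exp ((lam / 2 * coth lam : ℝ) * cdot ζ (conjCC ζ')) *
    Complex.exp (-(Complex.I * (lam / 2 : ℝ)) * csymp ζ (conjCC ζ')) *
    Complex.exp ((-(lam / 4 * coth lam * ‖ζ'‖ ^ 2) : ℝ) : ℂ) *
    Complex.exp ((lam / 2 * symp (reCC ζ') (imCC ζ') : ℝ) : ℂ)

/-! ### Twisted modulation spaces -/

/-- Membership of `F(ξ,η)` in the mixed norm space `L^{p,q}(ℝ²ⁿ × ℝ²ⁿ)`: the `L^p` norm is taken
in the first variable, then the `L^q` norm in the second. -/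
def MemMixedLp {n : ℕ} (p q : ℝ≥0∞) (F : RR n → RR n → ℂ) : Prop :=
  AEStronglyMeasurable (Function.uncurry F) volume ∧
    eLpNorm (fun η => eLpNorm (fun ξ => F ξ η) p volume) q volume < ∞

/-- The twisted modulation space `M_λ^{p,q}(ℝ²ⁿ)`: the tempered distributions `f` for which the
matrix coefficient `⟨f, Π_λ(ξ,η)g⟩` belongs to `L^{p,q}` for some non-zero Schwartz window `g`. -/
def modSpace (n : ℕ) (lam : ℝ) (p q : ℝ≥0∞) : Set 𝓢'(RR n, ℂ) :=
  {f | ∃ g : 𝓢(RR n, ℂ), g ≠ 0 ∧ MemMixedLp p q fun ξ η => pair f (twPi lam ξ η g)}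

end TwistedMod

end

/-! Both `τ_λ(ξ)` and `e_λ(η)` are ordinary time-frequency shifts of `ℝ²ⁿ`, and the prefactor of
`Π_λ(ξ,η)` is exactly the phase that symmetrises their product: `Π_λ(ξ,η)` is the Weyl operator
translating by `a = ξ + tanh(λ/2) Jη` with frequency `b = (λ/2) Jξ - c(λ) η`. Hence `Π_λ` is a
projective representation with unimodular cocycle, so replacing `f` by `Π_λ(ξ₀,η₀) f` only
translates its matrix coefficient and multiplies it by a phase, which the mixed norms do not see.
The operator `U_λ` is a unitary dilated Fourier transform, which exchanges translation and frequency
and so turns `Π_λ(ξ,η)` into `Π_λ(-η,ξ)`; it rotates the matrix coefficient, and the iterated norm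
of `L^{p,p}` is the `L^p` norm of the product, which is invariant under rotation.

Completing the square in the heat kernels, `B_λ g(ζ)` is a constant times
`exp(κ ζ·ζ) ∫ g(x) exp(-(c/2) x·x + w(ζ)·x) dx` with `c = c(λ)` and `w(ζ)` complex linear in `ζ`.
A Weyl operator acting on `g` shifts the parameter of the Gaussian by `c a - i b`, and this is
`w(ξ + iη)`; the exponential factors recombine to the multiplier of `ρ_λ(ξ + iη)` by polarising
the quadratic exponents. The Fourier transform multiplies the parameter of a Gaussian by `-i`. -/

noncomputable section

namespace TwistedMod

section Weyl

variable {V E : Type*} [NormedAddCommGroup V] [InnerProductSpace ℝ V]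

/-- The Weyl operator with translation `a` and frequency `b`, in the symmetric ordering: the
constant phase is chosen so that the cocycle in `weyl_weyl` is antisymmetric. -/
def weyl [SMul ℂ E] (a b : V) (f : V → E) (x : V) : E :=
  Circle.exp (inner ℝ b x - inner ℝ a b / 2) • f (x - a)

theorem weyl_weyl [MulAction ℂ E] (a b a' b' : V) (f : V → E) :
    weyl a b (weyl a' b' f) =
      (Circle.exp ((inner ℝ a' b - inner ℝ a b') / 2) : ℂ) • weyl (a + a') (b + b') f := by
  ext x
  simp only [weyl, Pi.smul_apply, ← Circle.smul_def, smul_smul, ← Circle.exp_add, sub_sub]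
  congr 2
  simp only [inner_sub_right, inner_add_left, inner_add_right, real_inner_comm a b']
  ring

theorem weyl_const_smul [MulAction ℂ E] (a b : V) (c : ℂ) (f : V → E) :
    weyl a b (c • f) = c • weyl a b f :=
  funext fun _ => smul_comm _ _ _

theorem weyl_comp_smul [SMul ℂ E] {r : ℝ} (hr : r ≠ 0) (a b : V) (f : V → E) :
    (fun x => weyl a b f (r • x)) = weyl (r⁻¹ • a) (r • b) fun x => f (r • x) := by
  ext x
  simp only [weyl, smul_sub, smul_inv_smul₀ hr, inner_smul_left, inner_smul_right, conj_trivial]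
  field_simp

end Weyl

section Fourier

variable {V E : Type*} [NormedAddCommGroup V] [InnerProductSpace ℝ V] [FiniteDimensional ℝ V]
  [MeasurableSpace V] [BorelSpace V] [NormedAddCommGroup E] [NormedSpace ℂ E]

theorem fourier_weyl (a b : V) (f : V → E) :
    𝓕 (weyl a b f) = weyl ((2 * Real.pi)⁻¹ • b) (-((2 * Real.pi) • a)) (𝓕 f) := by
  ext w
  rw [weyl, Real.fourier_eq, Real.fourier_eq, ← integral_add_right_eq_self _ a, Circle.smul_def,
    ← integral_smul]
  refine integral_congr_ae (.of_forall fun y => ?_)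
  simp only [weyl, add_sub_cancel_right, Real.fourierChar_apply', ← Circle.smul_def, smul_smul,
    ← Circle.exp_add]
  congr 2
  simp only [inner_add_left, inner_add_right, inner_sub_right, inner_neg_left, inner_neg_right,
    inner_smul_left, inner_smul_right, conj_trivial, real_inner_comm a b, real_inner_comm y b]
  field_simp
  ring

theorem fourier_const_smul (c : ℂ) (f : V → E) : 𝓕 (c • f) = c • 𝓕 f :=
  VectorFourier.fourierIntegral_const_smul ..

theorem fourierInv_const_smul (c : ℂ) (f : V → E) : 𝓕⁻ (c • f) = c • 𝓕⁻ f :=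
  VectorFourier.fourierIntegral_const_smul ..

theorem fourier_comp_smul {r : ℝ} (hr : r ≠ 0) (f : V → E) (w : V) :
    𝓕 (fun x => f (r • x)) w = |(r ^ Module.finrank ℝ V)⁻¹| • 𝓕 f (r⁻¹ • w) := by
  rw [Real.fourier_eq, Real.fourier_eq, ← Measure.integral_comp_smul]
  simp only [inner_smul_left, inner_smul_right, conj_trivial, inv_mul_cancel_left₀ hr]

theorem fourierInv_comp_smul {r : ℝ} (hr : r ≠ 0) (f : V → E) (w : V) :
    𝓕⁻ (fun x => f (r • x)) w = |(r ^ Module.finrank ℝ V)⁻¹| • 𝓕⁻ f (r⁻¹ • w) := by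
  simp only [Real.fourierInv_eq_fourier_neg, fourier_comp_smul hr, smul_neg]

theorem vectorFourier_smul_inner (r : ℝ) (f : V → E) (x : V) :
    VectorFourier.fourierIntegral Real.fourierChar volume (r • innerₗ V) f x = 𝓕 f (r • x) := by
  simp only [VectorFourier.fourierIntegral, Real.fourier_eq, inner_smul_right]
  rfl

theorem integral_fourier_smul_comp_smul [CompleteSpace E] (r : ℝ) {f : V → ℂ} {g : V → E}
    (hf : Integrable f) (hg : Integrable g) :
    ∫ x, 𝓕 f (r • x) • g x = ∫ x, f x • 𝓕 g (r • x) := by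
  have hL : Continuous fun p : V × V => (r • innerₗ V) p.1 p.2 := by
    change Continuous fun p : V × V => r * inner ℝ p.1 p.2
    fun_prop
  have hflip : (r • innerₗ V).flip = r • innerₗ V :=
    LinearMap.ext₂ fun x y => by simp [real_inner_comm]
  simpa only [hflip, vectorFourier_smul_inner] using
    VectorFourier.integral_fourierIntegral_smul_eq_flip (μ := volume) (ν := volume)
      Real.continuous_fourierChar hL hf hg

end Fourier

section PhaseSpace

variable {n : ℕ} {lam : ℝ}

theorem cexp_I_mul_ofReal (t : ℝ) : Complex.exp (Complex.I * t) = Circle.exp t := by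
  rw [Circle.coe_exp, mul_comm]

theorem tanh_mul_coth {s : ℝ} (hs : s ≠ 0) : Real.tanh s * coth s = 1 := by
  rw [coth, Real.tanh_eq_sinh_div_cosh, div_mul_div_cancel₀ (Real.cosh_pos s).ne',
    div_self (Real.sinh_ne_zero.2 hs)]

theorem coth_eq_half {s : ℝ} (hs : s ≠ 0) :
    coth s = (coth (s / 2) + Real.tanh (s / 2)) / 2 := by
  have hsinh : Real.sinh (s / 2) ≠ 0 := Real.sinh_ne_zero.2 (by positivity)
  have hcosh := (Real.cosh_pos (s / 2)).ne'
  obtain ⟨t, rfl⟩ : ∃ t, s = 2 * t := ⟨s / 2, by ring⟩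
  rw [mul_div_cancel_left₀ _ two_ne_zero] at *
  rw [coth, coth, Real.tanh_eq_sinh_div_cosh, Real.sinh_two_mul, Real.cosh_two_mul]
  field_simp

theorem cFun_mul_tanh (hlam : lam ≠ 0) : cFun lam * Real.tanh (lam / 2) = lam / 2 := by
  rw [cFun, mul_assoc, mul_comm (coth _), tanh_mul_coth (by positivity), mul_one]

theorem rotJ_add (ξ η : RR n) : rotJ (ξ + η) = rotJ ξ + rotJ η := by
  ext j
  cases j <;> simp [rotJ, add_comm]

theorem rotJ_zero : rotJ (0 : RR n) = 0 := by
  ext j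
  cases j <;> simp [rotJ]

theorem symp_eq_inner (ξ η : RR n) : symp ξ η = -inner ℝ (rotJ η) ξ := by
  simp [symp, PiLp.inner_apply, rotJ, sub_eq_add_neg, Finset.sum_add_distrib, add_comm, mul_comm]

theorem symp_swap (ξ η : RR n) : symp η ξ = -symp ξ η := by
  simp [symp]

theorem inner_rotJ_rotJ (ξ η : RR n) : inner ℝ (rotJ ξ) (rotJ η) = inner ℝ ξ η := by
  simp [PiLp.inner_apply, rotJ, add_comm]

/-- The vector by which the Weyl operator `Π_λ(ξ,η)` translates, see `coe_twPi`. -/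
def weylShift (lam : ℝ) (ξ η : RR n) : RR n := ξ + Real.tanh (lam / 2) • rotJ η

/-- The frequency by which the Weyl operator `Π_λ(ξ,η)` modulates, see `coe_twPi`. -/
def weylFreq (lam : ℝ) (ξ η : RR n) : RR n := (lam / 2) • rotJ ξ - cFun lam • η

theorem weylShift_add (lam : ℝ) (ξ η ξ' η' : RR n) :
    weylShift lam (ξ + ξ') (η + η') = weylShift lam ξ η + weylShift lam ξ' η' := by
  simp only [weylShift, rotJ_add, smul_add]
  abel

theorem weylFreq_add (lam : ℝ) (ξ η ξ' η' : RR n) :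
    weylFreq lam (ξ + ξ') (η + η') = weylFreq lam ξ η + weylFreq lam ξ' η' := by
  simp only [weylFreq, rotJ_add, smul_add]
  abel

theorem coe_twTrans (lam : ℝ) (ξ : RR n) (g : 𝓢(RR n, ℂ)) :
    ⇑(twTrans lam ξ g) = weyl ξ ((lam / 2) • rotJ ξ) g := by
  ext x
  rw [twTrans_apply, cexp_I_mul_ofReal, weyl, Circle.smul_def, smul_eq_mul, symp_eq_inner,
    inner_smul_left, inner_smul_right, inner_rotJ]
  simp

theorem coe_twMod (lam : ℝ) (η : RR n) (g : 𝓢(RR n, ℂ)) :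
    ⇑(twMod lam η g) = weyl (Real.tanh (lam / 2) • rotJ η) (-(cFun lam • η)) g := by
  ext x
  rw [twMod_apply, cexp_I_mul_ofReal, weyl, Circle.smul_def, smul_eq_mul, inner_neg_right,
    inner_smul_left, inner_smul_right, real_inner_comm η (rotJ η), inner_rotJ]
  simp [cFun, inner_smul_left]

theorem coe_twPi (hlam : lam ≠ 0) (ξ η : RR n) (g : 𝓢(RR n, ℂ)) :
    ⇑(twPi lam ξ η g) = weyl (weylShift lam ξ η) (weylFreq lam ξ η) g := by
  change Complex.exp _ • ⇑(twMod lam η (twTrans lam ξ g)) = _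
  rw [cexp_I_mul_ofReal, coe_twMod, coe_twTrans, weyl_weyl, smul_smul, ← Circle.coe_mul,
    ← Circle.exp_add]
  have cocycle_cancels : lam / 2 * coth lam * inner ℝ ξ η + (inner ℝ ξ (-(cFun lam • η)) -
      inner ℝ (Real.tanh (lam / 2) • rotJ η) ((lam / 2) • rotJ ξ)) / 2 = 0 := by
    simp only [coth_eq_half hlam, cFun, inner_neg_right, inner_smul_left, inner_smul_right,
      inner_rotJ_rotJ, conj_trivial, real_inner_comm ξ η]
    ring
  rw [cocycle_cancels, Circle.exp_zero, Circle.coe_one, one_smul, add_comm, neg_add_eq_sub]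
  rfl

/-- The symplectic form on phase space that is the cocycle of `Π_λ`, see `twPi_twPi`. -/
def piForm (lam : ℝ) (ξ η ξ' η' : RR n) : ℝ :=
  lam / 2 * (coth lam * (inner ℝ ξ η' - inner ℝ ξ' η) - symp ξ' ξ - symp η' η)

theorem continuous_piForm (lam : ℝ) (ξ η : RR n) :
    Continuous fun z : RR n × RR n => piForm lam ξ η z.1 z.2 := by
  have hξ : Continuous fun x => symp x ξ := (sympCLM ξ).continuous
  have hη : Continuous fun x => symp x η := (sympCLM η).continuous
  unfold piForm
  fun_prop

theorem weyl_cocycle_eq_piForm (hlam : lam ≠ 0) (ξ η ξ' η' : RR n) :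
    (inner ℝ (weylShift lam ξ' η') (weylFreq lam ξ η) -
      inner ℝ (weylShift lam ξ η) (weylFreq lam ξ' η')) / 2 = piForm lam ξ η ξ' η' := by
  have inner_shift_freq (ξ η ξ' η' : RR n) :
      inner ℝ (weylShift lam ξ η) (weylFreq lam ξ' η') =
        lam / 2 * (Real.tanh (lam / 2) * inner ℝ ξ' η - coth (lam / 2) * inner ℝ ξ η' -
          symp ξ ξ' + symp η' η) := by
    have h := tanh_mul_coth (s := lam / 2) (by positivity)
    simp only [weylShift, weylFreq, cFun, symp_eq_inner, inner_add_left, inner_sub_right,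
      inner_smul_left, inner_smul_right, inner_rotJ_rotJ, conj_trivial, real_inner_comm ξ,
      real_inner_comm η ξ']
    linear_combination (-(lam / 2) * inner ℝ (rotJ η) η') * h
  rw [inner_shift_freq, inner_shift_freq, piForm, coth_eq_half hlam, symp_swap ξ' ξ,
    symp_swap η' η]
  ring

theorem twPi_twPi (hlam : lam ≠ 0) (ξ η ξ' η' : RR n) (g : 𝓢(RR n, ℂ)) :
    twPi lam ξ η (twPi lam ξ' η' g) =
      (Circle.exp (piForm lam ξ η ξ' η') : ℂ) • twPi lam (ξ + ξ') (η + η') g := by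
  refine DFunLike.coe_injective ?_
  change _ = (Circle.exp (piForm lam ξ η ξ' η') : ℂ) • ⇑(twPi lam (ξ + ξ') (η + η') g)
  rw [coe_twPi hlam, coe_twPi hlam, coe_twPi hlam, weyl_weyl,
    weyl_cocycle_eq_piForm hlam, weylShift_add, weylFreq_add]

theorem twTrans_zero (lam : ℝ) : twTrans lam (0 : RR n) = .id ℂ _ := by
  ext g x
  simp [twTrans_apply, symp_eq_inner, rotJ_zero]

theorem twMod_zero (lam : ℝ) : twMod lam (0 : RR n) = .id ℂ _ := by
  ext g x
  simp [twMod_apply, rotJ_zero]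

theorem twPi_zero_right (lam : ℝ) (ξ : RR n) : twPi lam ξ 0 = twTrans lam ξ := by
  simp [twPi, twMod_zero]

theorem twPi_zero_left (lam : ℝ) (η : RR n) : twPi lam 0 η = twMod lam η := by
  simp [twPi, twTrans_zero]

theorem twTrans_twMod (hlam : lam ≠ 0) (ξ η : RR n) (g : 𝓢(RR n, ℂ)) :
    twTrans lam ξ (twMod lam η g) =
      (Circle.exp (lam / 2 * coth lam * inner ℝ ξ η) : ℂ) • twPi lam ξ η g := by
  rw [← twPi_zero_right, ← twPi_zero_left, twPi_twPi hlam, zero_add, add_zero]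
  simp [piForm, symp_eq_inner, rotJ_zero, mul_assoc]

end PhaseSpace

section FourierRotation

variable {n : ℕ} {lam : ℝ}

theorem coe_twU (hlam : lam ≠ 0) (g : 𝓢(RR n, ℂ)) :
    ⇑(twU lam hlam g) =
      ((scale lam hlam : ℝ) : ℂ) ^ n • fun x => 𝓕 ⇑g ((scale lam hlam : ℝ) • x) := by
  rw [← Complex.ofReal_pow, scale, Units.val_mk0, div_pow, div_eq_mul_inv]
  rfl

theorem coe_twUadj (hlam : lam ≠ 0) (g : 𝓢(RR n, ℂ)) :
    ⇑(twUadj lam hlam g) =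
      ((scale lam hlam : ℝ) : ℂ) ^ n • fun x => 𝓕⁻ ⇑g ((scale lam hlam : ℝ) • x) := by
  rw [← Complex.ofReal_pow, scale, Units.val_mk0, div_pow, div_eq_mul_inv,
    ← SchwartzMap.fourierInv_coe]
  rfl

theorem scale_pos (hlam : lam ≠ 0) : 0 < (scale lam hlam : ℝ) :=
  div_pos (cFun_pos hlam) Real.two_pi_pos

theorem two_pi_mul_scale (hlam : lam ≠ 0) : 2 * Real.pi * scale lam hlam = cFun lam :=
  mul_div_cancel₀ _ Real.two_pi_pos.ne'

theorem twU_twPi (hlam : lam ≠ 0) (ξ η : RR n) (g : 𝓢(RR n, ℂ)) :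
    twU lam hlam (twPi lam ξ η g) = twPi lam (-η) ξ (twU lam hlam g) := by
  have freq_eq_shift : (cFun lam)⁻¹ • weylFreq lam ξ η = weylShift lam (-η) ξ := by
    rw [inv_smul_eq_iff₀ (cFun_pos hlam).ne', weylFreq, weylShift, smul_add, smul_smul,
      cFun_mul_tanh hlam, smul_neg, neg_add_eq_sub]
  have shift_eq_freq : -(cFun lam • weylShift lam ξ η) = weylFreq lam (-η) ξ := by
    rw [weylFreq, weylShift, smul_add, smul_smul, cFun_mul_tanh hlam, rotJ_neg, smul_neg]
    abel
  refine DFunLike.coe_injective ?_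
  rw [coe_twPi hlam, coe_twU, coe_twU, coe_twPi hlam, fourier_weyl,
    weyl_comp_smul (scale_pos hlam).ne', weyl_const_smul, smul_smul, ← mul_inv, smul_neg,
    smul_smul, mul_comm _ (2 * Real.pi), two_pi_mul_scale,
    freq_eq_shift, shift_eq_freq]

theorem scale_pow_mul_abs_inv_finrank (hlam : lam ≠ 0) :
    (scale lam hlam : ℝ) ^ n * ((scale lam hlam : ℝ) ^ n *
      |((scale lam hlam : ℝ) ^ Module.finrank ℝ (RR n))⁻¹|) = 1 := by
  have h := scale_pos hlam
  rw [finrank_euclideanSpace, Fintype.card_sum, Fintype.card_fin, abs_of_pos (by positivity),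
    ← mul_assoc, ← pow_add, mul_inv_cancel₀ (by positivity)]

theorem twU_twUadj (hlam : lam ≠ 0) (g : 𝓢(RR n, ℂ)) :
    twU lam hlam (twUadj lam hlam g) = g := by
  have inversion : 𝓕 (𝓕⁻ ⇑g) = g := by
    rw [← SchwartzMap.fourierInv_coe, ← SchwartzMap.fourier_coe,
      FourierTransform.fourier_fourierInv_eq]
  ext x
  simp only [coe_twU, coe_twUadj, fourier_const_smul, Pi.smul_apply,
    fourier_comp_smul (scale_pos hlam).ne', inv_smul_smul₀ (scale_pos hlam).ne', inversion,
    ← Complex.coe_smul, ← Complex.ofReal_pow, smul_smul, ← Complex.ofReal_mul,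
    scale_pow_mul_abs_inv_finrank, Complex.ofReal_one, one_smul]

theorem twUadj_twU (hlam : lam ≠ 0) (g : 𝓢(RR n, ℂ)) :
    twUadj lam hlam (twU lam hlam g) = g := by
  have inversion : 𝓕⁻ (𝓕 ⇑g) = g := by
    rw [← SchwartzMap.fourier_coe, ← SchwartzMap.fourierInv_coe,
      FourierTransform.fourierInv_fourier_eq]
  ext x
  simp only [coe_twU, coe_twUadj, fourierInv_const_smul, Pi.smul_apply,
    fourierInv_comp_smul (scale_pos hlam).ne', inv_smul_smul₀ (scale_pos hlam).ne', inversion,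
    ← Complex.coe_smul, ← Complex.ofReal_pow, smul_smul, ← Complex.ofReal_mul,
    scale_pow_mul_abs_inv_finrank, Complex.ofReal_one, one_smul]

end FourierRotation

section TemperedDistributions

variable {n : ℕ} {lam : ℝ}

theorem pair_smul_right (f : 𝓢'(RR n, ℂ)) (c : ℂ) (g : 𝓢(RR n, ℂ)) :
    pair f (c • g) = conj c * pair f g := by
  rw [pair, conjS_smul, map_smul, smul_eq_mul, pair]

theorem pair_ext {f f' : 𝓢'(RR n, ℂ)} (h : ∀ g, pair f g = pair f' g) : f = f' := by
  ext g
  simpa only [pair, conjS_conjS] using h (conjS g)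

theorem pair_twPiD (hlam : lam ≠ 0) (ξ η : RR n) (f : 𝓢'(RR n, ℂ)) (g : 𝓢(RR n, ℂ)) :
    pair (twPiD lam ξ η f) g = pair f (twPi lam (-ξ) (-η) g) := by
  change Complex.exp _ * pair (twModD lam η (twTransD lam ξ f)) g = _
  rw [twModD, pair_dualExt, twTransD, pair_dualExt, twTrans_twMod hlam, pair_smul_right,
    inner_neg_neg, cexp_I_mul_ofReal, ← Circle.coe_inv_eq_conj, ← mul_assoc, ← Circle.coe_mul,
    mul_inv_cancel, Circle.coe_one, one_mul]

theorem twUD_twPiD_twUadjD (hlam : lam ≠ 0) (ξ η : RR n) (f : 𝓢'(RR n, ℂ)) :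
    twUD lam hlam (twPiD lam ξ η (twUadjD lam hlam f)) = twPiD lam (-η) ξ f := by
  refine pair_ext fun g => ?_
  rw [twUD, pair_dualExt, pair_twPiD hlam, twUadjD, pair_dualExt, twU_twPi, twU_twUadj,
    pair_twPiD hlam]

end TemperedDistributions

section MixedNorms

variable {α β E : Type*} [MeasurableSpace α] [MeasurableSpace β] {μ : Measure α} {ν : Measure β}

theorem essSup_essSup_eq_essSup_prod [SFinite ν] {f : α × β → ℝ≥0∞}
    (hf : AEMeasurable f (μ.prod ν)) :
    essSup (fun x => essSup (fun y => f (x, y)) ν) μ = essSup f (μ.prod ν) := by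
  refine le_antisymm ?_ ?_
  · refine essSup_le_of_ae_le _ ?_
    filter_upwards [Measure.ae_ae_of_ae_prod (ENNReal.ae_le_essSup (μ := μ.prod ν) f)] with x hx
    exact essSup_le_of_ae_le _ hx
  · refine essSup_le_of_ae_le _ ?_
    set M := essSup (fun x => essSup (fun y => f (x, y)) ν) μ
    have mk_le : ∀ᵐ z ∂μ.prod ν, hf.mk f z ≤ M := by
      refine (Measure.ae_prod_iff_ae_ae (measurableSet_le hf.measurable_mk measurable_const)).2 ?_
      filter_upwards [Measure.ae_ae_of_ae_prod hf.ae_eq_mk,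
        ENNReal.ae_le_essSup fun x => essSup (fun y => f (x, y)) ν] with x hx hxM
      filter_upwards [hx, ENNReal.ae_le_essSup fun y => f (x, y)] with y hy hyM
      exact hy.symm.le.trans (hyM.trans hxM)
    filter_upwards [hf.ae_eq_mk, mk_le] with z hz hzM
    exact hz.le.trans hzM

theorem eLpNorm_eLpNorm_eq_eLpNorm_prod [SFinite ν] [TopologicalSpace E] [ContinuousENorm E]
    (p : ℝ≥0∞) {f : α × β → E} (hf : AEStronglyMeasurable f (μ.prod ν)) :
    eLpNorm (fun x => eLpNorm (fun y => f (x, y)) p ν) p μ = eLpNorm f p (μ.prod ν) := by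
  rcases eq_or_ne p 0 with rfl | hp0
  · simp only [eLpNorm_exponent_zero]
  rcases eq_or_ne p ∞ with rfl | hp
  · simpa only [eLpNorm_exponent_top, eLpNormEssSup, enorm_eq_self] using
      essSup_essSup_eq_essSup_prod hf.enorm
  · have hp_pos : 0 < p.toReal := ENNReal.toReal_pos hp0 hp
    simp only [eLpNorm_eq_lintegral_rpow_enorm_toReal hp0 hp, enorm_eq_self, ← ENNReal.rpow_mul,
      one_div, inv_mul_cancel₀ hp_pos.ne', ENNReal.rpow_one]
    rw [lintegral_prod _ (hf.enorm.pow_const _)]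

theorem eLpNorm_eLpNorm_eq_eLpNorm_prod_symm [SFinite μ] [SFinite ν] [TopologicalSpace E]
    [ContinuousENorm E] (p : ℝ≥0∞) {f : α × β → E} (hf : AEStronglyMeasurable f (μ.prod ν)) :
    eLpNorm (fun y => eLpNorm (fun x => f (x, y)) p μ) p ν = eLpNorm f p (μ.prod ν) := by
  have hswap : MeasurePreserving Prod.swap (ν.prod μ) (μ.prod ν) := Measure.measurePreserving_swap
  have iterated_eq := eLpNorm_eLpNorm_eq_eLpNorm_prod p (hf.comp_measurePreserving hswap)
  have swap_eq := eLpNorm_comp_measurePreserving (p := p) hf hswap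
  exact iterated_eq.trans swap_eq

theorem eLpNorm_comp_add_left [AddGroup α] [MeasurableAdd α] [μ.IsAddLeftInvariant]
    [TopologicalSpace E] [ContinuousENorm E] (p : ℝ≥0∞) (f : α → E) (a : α) :
    eLpNorm (fun x => f (a + x)) p μ = eLpNorm f p μ := by
  conv_rhs => rw [← map_add_left_eq_self μ a]
  exact ((measurableEmbedding_addLeft a).eLpNorm_map_measure (g := f)).symm

variable {n : ℕ} {p q : ℝ≥0∞} {F G : RR n → RR n → ℂ}

theorem MemMixedLp.comp_add_left (hF : MemMixedLp p q F) (a b : RR n) :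
    MemMixedLp p q fun ξ η => F (a + ξ) (b + η) := by
  refine ⟨hF.1.comp_measurePreserving
    ((measurePreserving_add_left volume a).prod (measurePreserving_add_left volume b)), ?_⟩
  have h_inner (η : RR n) :
      eLpNorm (fun ξ => F (a + ξ) η) p volume = eLpNorm (fun ξ => F ξ η) p volume :=
    eLpNorm_comp_add_left p (fun ξ => F ξ η) a
  simp only [h_inner]
  rw [eLpNorm_comp_add_left q fun η => eLpNorm (fun ξ => F ξ η) p volume]
  exact hF.2

theorem MemMixedLp.of_norm_eq (hF : MemMixedLp p q F)
    (hG : AEStronglyMeasurable (Function.uncurry G) volume) (h : ∀ ξ η, ‖G ξ η‖ = ‖F ξ η‖) :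
    MemMixedLp p q G := by
  have h_inner (η : RR n) :
      eLpNorm (fun ξ => G ξ η) p volume = eLpNorm (fun ξ => F ξ η) p volume :=
    eLpNorm_congr_norm_ae (.of_forall fun ξ => h ξ η)
  exact ⟨hG, by simpa only [h_inner] using hF.2⟩

theorem memMixedLp_self_iff : MemMixedLp p p F ↔ MemLp (Function.uncurry F) p volume := by
  rw [MemMixedLp, MemLp, Measure.volume_eq_prod]
  refine and_congr_right fun hF => ?_
  have iterated_eq := eLpNorm_eLpNorm_eq_eLpNorm_prod_symm p hF
  simp only [Function.uncurry_apply_pair] at iterated_eq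
  rw [iterated_eq]

theorem MemMixedLp.rotate (hF : MemMixedLp p p F) : MemMixedLp p p fun ξ η => F η (-ξ) := by
  rw [memMixedLp_self_iff] at hF ⊢
  exact hF.comp_measurePreserving
    (((MeasurePreserving.id volume).prod (Measure.measurePreserving_neg volume)).comp
      Measure.measurePreserving_swap)

end MixedNorms

section ModulationSpaces

variable {n : ℕ} {lam : ℝ} {p q : ℝ≥0∞} {f : 𝓢'(RR n, ℂ)}

theorem dualExt_twPi_mem_modSpace (hlam : lam ≠ 0) (hf : f ∈ modSpace n lam p q) (ξ₀ η₀ : RR n) :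
    dualExt (twPi lam ξ₀ η₀) f ∈ modSpace n lam p q := by
  obtain ⟨g, hg, hF⟩ := hf
  have coefficient (ξ η : RR n) : pair (dualExt (twPi lam ξ₀ η₀) f) (twPi lam ξ η g) =
      conj (Circle.exp (piForm lam ξ₀ η₀ ξ η) : ℂ) *
        pair f (twPi lam (ξ₀ + ξ) (η₀ + η) g) := by
    rw [pair_dualExt, twPi_twPi hlam, pair_smul_right]
  have h := hF.comp_add_left ξ₀ η₀
  refine ⟨g, hg, h.of_norm_eq ?_ fun ξ η => ?_⟩
  · have hphase : Continuous fun z : RR n × RR n =>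
        conj (Circle.exp (piForm lam ξ₀ η₀ z.1 z.2) : ℂ) := by
      have := continuous_piForm lam ξ₀ η₀
      fun_prop
    simp only [coefficient]
    exact hphase.aestronglyMeasurable.mul h.1
  · rw [coefficient, norm_mul, RCLike.norm_conj, Circle.norm_coe, one_mul]

theorem twTransD_mem_modSpace (hlam : lam ≠ 0) (hf : f ∈ modSpace n lam p q) (ξ : RR n) :
    twTransD lam ξ f ∈ modSpace n lam p q := by
  rw [twTransD, ← twPi_zero_right]
  exact dualExt_twPi_mem_modSpace hlam hf _ _

theorem twModD_mem_modSpace (hlam : lam ≠ 0) (hf : f ∈ modSpace n lam p q) (η : RR n) :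
    twModD lam η f ∈ modSpace n lam p q := by
  rw [twModD, ← twPi_zero_left]
  exact dualExt_twPi_mem_modSpace hlam hf _ _

theorem twUD_mem_modSpace (hlam : lam ≠ 0) (hf : f ∈ modSpace n lam p p) :
    twUD lam hlam f ∈ modSpace n lam p p := by
  obtain ⟨g, hg, hF⟩ := hf
  have window_ne_zero : twU lam hlam g ≠ 0 := fun h0 =>
    hg (by rw [← twUadj_twU hlam g, h0, map_zero])
  have coefficient (ξ η : RR n) : pair (twUD lam hlam f) (twPi lam ξ η (twU lam hlam g)) =
      pair f (twPi lam η (-ξ) g) := by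
    rw [twUD, pair_dualExt, ← neg_neg ξ, ← twU_twPi, twUadj_twU, neg_neg]
  exact ⟨twU lam hlam g, window_ne_zero, by simpa only [coefficient] using hF.rotate⟩

end ModulationSpaces

section ComplexPhaseSpace

variable {n : ℕ}

theorem cdot_comm (ζ ω : CC n) : cdot ζ ω = cdot ω ζ :=
  dotProduct_comm _ _

theorem cdot_add_left (ζ ζ' ω : CC n) : cdot (ζ + ζ') ω = cdot ζ ω + cdot ζ' ω :=
  add_dotProduct _ _ _

theorem cdot_add_right (ζ ω ω' : CC n) : cdot ζ (ω + ω') = cdot ζ ω + cdot ζ ω' :=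
  dotProduct_add _ _ _

theorem cdot_neg_left (ζ ω : CC n) : cdot (-ζ) ω = -cdot ζ ω :=
  neg_dotProduct _ _

theorem cdot_neg_right (ζ ω : CC n) : cdot ζ (-ω) = -cdot ζ ω :=
  dotProduct_neg _ _

theorem cdot_sub_left (ζ ζ' ω : CC n) : cdot (ζ - ζ') ω = cdot ζ ω - cdot ζ' ω :=
  sub_dotProduct _ _ _

theorem cdot_sub_right (ζ ω ω' : CC n) : cdot ζ (ω - ω') = cdot ζ ω - cdot ζ ω' :=
  dotProduct_sub _ _ _

theorem cdot_smul_left (c : ℂ) (ζ ω : CC n) : cdot (c • ζ) ω = c * cdot ζ ω :=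
  smul_dotProduct _ _ _

theorem cdot_smul_right (c : ℂ) (ζ ω : CC n) : cdot ζ (c • ω) = c * cdot ζ ω :=
  dotProduct_smul _ _ _

theorem toCC_add (ξ η : RR n) : toCC (ξ + η) = toCC ξ + toCC η := by
  ext j
  simp [toCC]

theorem toCC_sub (ξ η : RR n) : toCC (ξ - η) = toCC ξ - toCC η := by
  ext j
  simp [toCC]

theorem toCC_smul (r : ℝ) (ξ : RR n) : toCC (r • ξ) = (r : ℂ) • toCC ξ := by
  ext j
  simp [toCC]

theorem cdot_toCC_toCC (ξ η : RR n) : cdot (toCC ξ) (toCC η) = (inner ℝ ξ η : ℝ) := by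
  simp [PiLp.inner_apply, cdot, toCC, mul_comm]

theorem conjCC_toCC_add_I_smul (ξ η : RR n) :
    conjCC (toCC ξ + Complex.I • toCC η) = toCC ξ - Complex.I • toCC η := by
  ext j
  simp [conjCC, toCC, sub_eq_add_neg]

theorem cdot_conjCC_self (ζ : CC n) : cdot ζ (conjCC ζ) = (‖ζ‖ ^ 2 : ℝ) := by
  simp [EuclideanSpace.norm_sq_eq, cdot, conjCC, Complex.mul_conj']

theorem csymp_conjCC_self (ζ : CC n) :
    csymp ζ (conjCC ζ) = -2 * Complex.I * (symp (reCC ζ) (imCC ζ) : ℝ) := by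
  simp only [csymp, symp, conjCC, reCC, imCC, Complex.ofReal_sum, Finset.mul_sum]
  refine Finset.sum_congr rfl fun i _ => ?_
  rw [Complex.ext_iff]
  simp
  ring

/-- The complex-linear extension of `rotJ`, through which `csymp` becomes a dot product. -/
def rotJC : CC n →ₗ[ℂ] CC n where
  toFun ζ := WithLp.toLp 2 (Sum.elim (fun i => ζ (Sum.inr i)) fun i => -ζ (Sum.inl i))
  map_add' ζ ω := by
    ext j
    cases j <;> simp [add_comm]
  map_smul' c ζ := by
    ext j
    cases j <;> simp

theorem rotJC_toCC (ξ : RR n) : rotJC (toCC ξ) = toCC (rotJ ξ) := by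
  ext j
  cases j <;> simp [rotJC, toCC, rotJ]

theorem csymp_eq_cdot_rotJC (ζ ω : CC n) : csymp ζ ω = cdot (rotJC ζ) ω := by
  simp [csymp, cdot, rotJC, Finset.sum_add_distrib, sub_eq_add_neg, mul_comm]

theorem cdot_rotJC_rotJC (ζ ω : CC n) : cdot (rotJC ζ) (rotJC ω) = cdot ζ ω := by
  simp [cdot, rotJC, add_comm]

theorem cdot_rotJC_left (ζ ω : CC n) : cdot (rotJC ζ) ω = -cdot ζ (rotJC ω) := by
  simp [cdot, rotJC, add_comm]

end ComplexPhaseSpace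

section Gaussians

variable {n : ℕ} {c : ℝ}

/-- The Gaussian of width `c` with complex linear term `v`: for `c = c(λ)` these are the integral
kernels of the twisted Bargmann transform. -/
def gaussian (c : ℝ) (v : CC n) (x : RR n) : ℂ :=
  Complex.exp (-((c / 2 : ℝ) : ℂ) * cdot (toCC x) (toCC x) + cdot v (toCC x))

theorem gaussian_toLp (c : ℝ) (v : CC n) (x : Fin n ⊕ Fin n → ℝ) :
    gaussian c v (WithLp.toLp 2 x) =
      Complex.exp (-((c / 2 : ℝ) : ℂ) * ∑ j, (x j : ℂ) ^ 2 + ∑ j, v j * x j) := by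
  simp [gaussian, cdot, toCC, sq]

theorem integrable_gaussian (hc : 0 < c) (v : CC n) : Integrable (gaussian c v) := by
  have hcoord : gaussian c v ∘ WithLp.toLp 2 = _ := funext (gaussian_toLp c v)
  rw [← (PiLp.volume_preserving_toLp (Fin n ⊕ Fin n)).integrable_comp_emb
    (MeasurableEquiv.toLp 2 _).measurableEmbedding, hcoord]
  exact GaussianFourier.integrable_cexp_neg_mul_sum_add (by simpa using hc) _

theorem integral_gaussian (hc : 0 < c) (v : CC n) :
    ∫ x, gaussian c v x = ((2 * Real.pi / c : ℝ) : ℂ) ^ n * Complex.exp (cdot v v / (2 * c)) := by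
  have hc' : (c : ℂ) ≠ 0 := by exact_mod_cast hc.ne'
  have half_card : (Fintype.card (Fin n ⊕ Fin n) : ℂ) / 2 = n := by simp
  rw [← (PiLp.volume_preserving_toLp (Fin n ⊕ Fin n)).integral_comp
    (MeasurableEquiv.toLp 2 _).measurableEmbedding]
  simp only [gaussian_toLp]
  rw [GaussianFourier.integral_cexp_neg_mul_sum_add (by simpa using hc), half_card,
    Complex.cpow_natCast]
  congr 2
  · push_cast
    field_simp
  · simp only [cdot, sq]
    push_cast
    ring

theorem fourierChar_smul_gaussian (c : ℝ) (v : CC n) (x y : RR n) :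
    Real.fourierChar (-inner ℝ x ((c / (2 * Real.pi)) • y)) • gaussian c v x =
      gaussian c (v - (Complex.I * c) • toCC y) x := by
  have hpi : (Real.pi : ℂ) ≠ 0 := by exact_mod_cast Real.pi_ne_zero
  rw [Circle.smul_def, Real.fourierChar_apply, smul_eq_mul, gaussian, gaussian, ← Complex.exp_add,
    cdot_sub_left, cdot_smul_left, cdot_toCC_toCC y, inner_smul_right, real_inner_comm]
  congr 1
  push_cast
  field_simp
  ring

theorem fourier_gaussian (hc : 0 < c) (v : CC n) (y : RR n) :
    𝓕 (gaussian c v) ((c / (2 * Real.pi)) • y) =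
      ((2 * Real.pi / c : ℝ) : ℂ) ^ n * Complex.exp (cdot v v / (2 * c)) *
        gaussian c (-(Complex.I • v)) y := by
  have hc' : (c : ℂ) ≠ 0 := by exact_mod_cast hc.ne'
  rw [Real.fourier_eq]
  simp only [fourierChar_smul_gaussian]
  rw [integral_gaussian hc, gaussian, mul_assoc, ← Complex.exp_add]
  congr 2
  simp only [cdot_sub_left, cdot_sub_right, cdot_smul_left, cdot_smul_right, cdot_neg_left,
    cdot_comm (toCC y) v]
  push_cast
  field_simp
  linear_combination ((c : ℂ) ^ 2 * cdot (toCC y) (toCC y)) * Complex.I_sq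

theorem integral_weyl_mul_gaussian (c : ℝ) (v : CC n) (a b : RR n) (g : RR n → ℂ) :
    ∫ x, weyl a b g x * gaussian c v x =
      Complex.exp (cdot v (toCC a) -
        cdot ((c : ℂ) • toCC a - Complex.I • toCC b) (toCC a) / 2) *
      ∫ x, g x * gaussian c (v - ((c : ℂ) • toCC a - Complex.I • toCC b)) x := by
  rw [← integral_add_right_eq_self _ a, ← integral_const_mul]
  refine integral_congr_ae (.of_forall fun x => ?_)
  simp only [weyl, gaussian, add_sub_cancel_right, Circle.smul_def, smul_eq_mul, Circle.coe_exp]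
  rw [mul_right_comm, ← Complex.exp_add, mul_left_comm, ← Complex.exp_add, mul_comm]
  congr 2
  simp only [toCC_add, cdot_add_left, cdot_add_right, cdot_sub_left, cdot_smul_left,
    cdot_toCC_toCC, inner_add_right, real_inner_comm a x, real_inner_comm a b]
  push_cast
  ring

theorem integral_twU_mul_gaussian {lam : ℝ} (hlam : lam ≠ 0) (g : 𝓢(RR n, ℂ)) (v : CC n) :
    ∫ x, twU lam hlam g x * gaussian (cFun lam) v x =
      Complex.exp (cdot v v / (2 * cFun lam)) *
        ∫ x, g x * gaussian (cFun lam) (-(Complex.I • v)) x := by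
  have hc := cFun_pos hlam
  have normalization :
      ((scale lam hlam : ℝ) : ℂ) ^ n * ((2 * Real.pi / cFun lam : ℝ) : ℂ) ^ n = 1 := by
    rw [← mul_pow, ← Complex.ofReal_mul, scale, Units.val_mk0,
      div_mul_div_cancel₀ Real.two_pi_pos.ne', div_self hc.ne', Complex.ofReal_one, one_pow]
  have multiplication_formula :=
    integral_fourier_smul_comp_smul (scale lam hlam) g.integrable (integrable_gaussian hc v)
  simp only [smul_eq_mul] at multiplication_formula
  simp only [coe_twU, Pi.smul_apply, smul_eq_mul, mul_assoc, integral_const_mul,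
    multiplication_formula]
  simp only [scale, Units.val_mk0] at normalization ⊢
  simp only [fourier_gaussian hc, mul_left_comm (g _), integral_const_mul]
  rw [← mul_assoc, ← mul_assoc, normalization, one_mul]

end Gaussians

section Bargmann

variable {n : ℕ} {lam : ℝ}

/-- The parameter `c(λ) ζ - i(λ/2) J ζ` of the Gaussian against which `B_λ g(ζ)` integrates `g`. -/
def bargmannVec (lam : ℝ) : CC n →ₗ[ℂ] CC n :=
  (cFun lam : ℂ) • LinearMap.id - (Complex.I * (lam / 2 : ℝ)) • rotJC

theorem bargmannVec_apply (lam : ℝ) (ζ : CC n) :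
    bargmannVec lam ζ = (cFun lam : ℂ) • ζ - (Complex.I * (lam / 2 : ℝ)) • rotJC ζ :=
  rfl

/-- The coefficient of `ζ·ζ` in the exponential factor of `B_λ`, see `bargmann_eq`. -/
def bargmannExp (lam : ℝ) : ℝ := lam / 8 * (Real.tanh (lam / 2) - coth (lam / 2))

/-- The constant factor of `B_λ`, see `bargmann_eq`. -/
def bargmannConst (n : ℕ) (lam : ℝ) : ℝ :=
  ((4 * Real.pi) ^ n)⁻¹ * lam ^ n * (Real.sinh (lam / 2) ^ n)⁻¹

theorem cdot_bargmannVec_self (hlam : lam ≠ 0) (ζ : CC n) :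
    cdot (bargmannVec lam ζ) (bargmannVec lam ζ) / (2 * cFun lam) =
      -(2 * bargmannExp lam) * cdot ζ ζ := by
  have hc : (cFun lam : ℂ) ≠ 0 := by exact_mod_cast (cFun_pos hlam).ne'
  have exponent_eq : cFun lam ^ 2 - (lam / 2) ^ 2 = -(2 * bargmannExp lam) * (2 * cFun lam) := by
    have cFun_eq : cFun lam = lam / 2 * coth (lam / 2) := rfl
    rw [bargmannExp]
    linear_combination (lam / 2) * cFun_mul_tanh hlam + cFun lam * cFun_eq
  have cdot_rotJC_self : cdot ζ (rotJC ζ) = 0 := by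
    have h := cdot_rotJC_left ζ ζ
    rw [cdot_comm] at h
    exact self_eq_neg.1 h
  have exponent_eq' := congrArg Complex.ofReal exponent_eq
  push_cast at exponent_eq'
  rw [div_eq_iff (by simpa using hc)]
  simp only [bargmannVec_apply, cdot_sub_left, cdot_sub_right, cdot_smul_left, cdot_smul_right,
    cdot_rotJC_rotJC, cdot_comm (rotJC ζ) ζ, cdot_rotJC_self]
  push_cast
  linear_combination cdot ζ ζ * exponent_eq' + (lam / 2) ^ 2 * cdot ζ ζ * Complex.I_sq

theorem heatKernel_half_sub_mul_cexp (lam : ℝ) (ζ : CC n) (x : RR n) :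
    heatKernel lam (1 / 2) (ζ - toCC x) *
        Complex.exp (-(Complex.I * (lam / 2 : ℝ)) * csymp ζ (toCC x)) =
      heatKernel lam (1 / 2) ζ * gaussian (cFun lam) (bargmannVec lam ζ) x := by
  rw [heatKernel, heatKernel, gaussian, mul_assoc (Complex.ofReal _),
    mul_assoc (Complex.ofReal _), ← Complex.exp_add, ← Complex.exp_add, one_div_mul_eq_div]
  congr 2
  simp only [bargmannVec_apply, csymp_eq_cdot_rotJC, cdot_sub_left, cdot_sub_right,
    cdot_smul_left, cdot_comm (toCC x) ζ, cFun]
  push_cast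
  ring

theorem bargmann_eq (hlam : lam ≠ 0) (g : RR n → ℂ) (ζ : CC n) :
    bargmann lam g ζ = bargmannConst n lam * Complex.exp (bargmannExp lam * cdot ζ ζ) *
      ∫ x, g x * gaussian (cFun lam) (bargmannVec lam ζ) x := by
  have cConst_ne_zero : (cConst n lam : ℂ) ≠ 0 := by
    have := Real.sinh_ne_zero.2 hlam
    rw [cConst]
    exact_mod_cast (by positivity)
  have heatKernel_one : heatKernel lam 1 ζ =
      cConst n lam * Complex.exp (-((lam / 4 * coth lam : ℝ) : ℂ) * cdot ζ ζ) := by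
    rw [heatKernel, one_mul, cConst]
  have heatKernel_half : heatKernel lam (1 / 2) ζ =
      bargmannConst n lam * Complex.exp (-((lam / 4 * coth (lam / 2) : ℝ) : ℂ) * cdot ζ ζ) := by
    rw [heatKernel, one_div_mul_eq_div, bargmannConst]
  have exponential_quotient : Complex.exp (bargmannExp lam * cdot ζ ζ) =
      (Complex.exp (-((lam / 4 * coth lam : ℝ) : ℂ) * cdot ζ ζ))⁻¹ *
        Complex.exp (-((lam / 4 * coth (lam / 2) : ℝ) : ℂ) * cdot ζ ζ) := by
    rw [← Complex.exp_neg, ← Complex.exp_add, coth_eq_half hlam, bargmannExp]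
    congr 1
    push_cast
    ring
  simp only [bargmann, mul_assoc (g _), heatKernel_half_sub_mul_cexp,
    mul_left_comm (g _) (heatKernel _ _ _), integral_const_mul]
  rw [heatKernel_one, heatKernel_half, exponential_quotient]
  field_simp

theorem bargmann_twU (hlam : lam ≠ 0) (g : 𝓢(RR n, ℂ)) (ζ : CC n) :
    bargmann lam (twU lam hlam g) ζ = bargmann lam g (-(Complex.I • ζ)) := by
  have cdot_rotated : cdot (-(Complex.I • ζ)) (-(Complex.I • ζ)) = -cdot ζ ζ := by
    simp only [cdot_neg_left, cdot_neg_right, cdot_smul_left, cdot_smul_right]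
    linear_combination cdot ζ ζ * Complex.I_sq
  rw [bargmann_eq hlam, bargmann_eq hlam, integral_twU_mul_gaussian, cdot_bargmannVec_self hlam,
    map_neg, map_smul, cdot_rotated, ← mul_assoc, mul_assoc (bargmannConst n lam : ℂ),
    ← Complex.exp_add]
  congr 3
  ring

/-- The sesquilinear form `(λ/2) ((coth λ) ζ·conj ζ' - i[ζ, conj ζ'])` whose exponential is the
multiplier of `ρ_λ`, see `fockRep_eq`. -/
def fockForm (lam : ℝ) (ζ ζ' : CC n) : ℂ :=
  lam / 2 * (coth lam * cdot ζ (conjCC ζ') - Complex.I * csymp ζ (conjCC ζ'))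

theorem fockRep_eq (lam : ℝ) (ζ' : CC n) (F : CC n → ℂ) (ζ : CC n) :
    fockRep lam ζ' F ζ =
      F (ζ - ζ') * Complex.exp (fockForm lam ζ ζ' - fockForm lam ζ' ζ' / 2) := by
  simp only [fockRep, fockForm, mul_assoc, ← Complex.exp_add, cdot_conjCC_self,
    csymp_conjCC_self]
  congr 2
  push_cast
  linear_combination (lam / 2 * (symp (reCC ζ') (imCC ζ') : ℂ)) * Complex.I_sq

theorem bargmannVec_toCC_add_I_smul (hlam : lam ≠ 0) (ξ η : RR n) :
    bargmannVec lam (toCC ξ + Complex.I • toCC η) =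
      (cFun lam : ℂ) • toCC (weylShift lam ξ η) - Complex.I • toCC (weylFreq lam ξ η) := by
  have h := congrArg Complex.ofReal (cFun_mul_tanh hlam)
  rw [Complex.ofReal_mul] at h
  simp only [bargmannVec_apply, weylShift, weylFreq, map_add, map_smul, rotJC_toCC, toCC_add,
    toCC_sub, toCC_smul, smul_add, smul_sub, smul_smul, h]
  rw [← mul_assoc, Complex.I_mul_I]
  module

theorem cdot_bargmannVec_weylShift (hlam : lam ≠ 0) (ξ η : RR n) (ζ : CC n) :
    cdot (bargmannVec lam ζ) (toCC (weylShift lam ξ η)) =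
      -(2 * bargmannExp lam) * cdot ζ (toCC ξ + Complex.I • toCC η) +
        fockForm lam ζ (toCC ξ + Complex.I • toCC η) := by
  have h := congrArg Complex.ofReal (cFun_mul_tanh hlam)
  push_cast at h
  simp only [bargmannVec_apply, weylShift, fockForm, bargmannExp, conjCC_toCC_add_I_smul,
    csymp_eq_cdot_rotJC, toCC_add, toCC_smul, ← rotJC_toCC, cdot_sub_left, cdot_sub_right,
    cdot_add_right, cdot_smul_left, cdot_smul_right, cdot_rotJC_rotJC, cdot_rotJC_left ζ (toCC η),
    coth_eq_half hlam]
  push_cast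
  rw [cFun] at *
  push_cast at *
  linear_combination cdot ζ (rotJC (toCC η)) * h + lam / 2 * cdot ζ (rotJC (toCC η)) * Complex.I_sq

theorem bargmann_twPi (hlam : lam ≠ 0) (ξ η : RR n) (g : 𝓢(RR n, ℂ)) :
    bargmann lam (twPi lam ξ η g) =
      fockRep lam (toCC ξ + Complex.I • toCC η) (bargmann lam g) := by
  ext ζ
  rw [fockRep_eq, bargmann_eq hlam, bargmann_eq hlam, coe_twPi hlam, integral_weyl_mul_gaussian,
    ← bargmannVec_toCC_add_I_smul hlam, ← map_sub, cdot_bargmannVec_weylShift hlam,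
    cdot_bargmannVec_weylShift hlam]
  set ζ' := toCC ξ + Complex.I • toCC η
  have exponents_eq : bargmannExp lam * cdot ζ ζ +
      (-(2 * bargmannExp lam) * cdot ζ ζ' + fockForm lam ζ ζ' -
        (-(2 * bargmannExp lam) * cdot ζ' ζ' + fockForm lam ζ' ζ') / 2) =
      bargmannExp lam * cdot (ζ - ζ') (ζ - ζ') +
        (fockForm lam ζ ζ' - fockForm lam ζ' ζ' / 2) := by
    rw [cdot_sub_left, cdot_sub_right, cdot_sub_right, cdot_comm ζ' ζ]
    ring
  rw [← mul_assoc, mul_assoc (bargmannConst n lam : ℂ), ← Complex.exp_add, exponents_eq,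
    Complex.exp_add]
  ring

end Bargmann

end TwistedMod

end

theorem mainTheorem6_general (n : ℕ) (lam : ℝ) (hlam : lam ≠ 0) :
    ((∀ (ξ η : TwistedMod.RR n) (g : 𝓢(TwistedMod.RR n, ℂ)),
        TwistedMod.bargmann lam (TwistedMod.twPi lam ξ η g)
          = TwistedMod.fockRep lam (TwistedMod.toCC ξ + Complex.I • TwistedMod.toCC η)
              (TwistedMod.bargmann lam g)) ∧
      (∀ (g : 𝓢(TwistedMod.RR n, ℂ)) (ζ : TwistedMod.CC n),
        TwistedMod.bargmann lam (TwistedMod.twU lam hlam g) ζ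
          = TwistedMod.bargmann lam g (-(Complex.I • ζ)))) ∧
    (∀ (p q : ℝ≥0∞), 0 < p → 0 < q → ∀ f ∈ TwistedMod.modSpace n lam p q,
      (∀ ξ : TwistedMod.RR n, TwistedMod.twTransD lam ξ f ∈ TwistedMod.modSpace n lam p q) ∧
      (∀ η : TwistedMod.RR n, TwistedMod.twModD lam η f ∈ TwistedMod.modSpace n lam p q)) ∧
    (∀ (ξ η : TwistedMod.RR n) (f : 𝓢'(TwistedMod.RR n, ℂ)),
      TwistedMod.twUD lam hlam (TwistedMod.twPiD lam ξ η (TwistedMod.twUadjD lam hlam f))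
        = TwistedMod.twPiD lam (-η) ξ f) ∧
    (∀ p : ℝ≥0∞, 0 < p → ∀ f ∈ TwistedMod.modSpace n lam p p,
      TwistedMod.twUD lam hlam f ∈ TwistedMod.modSpace n lam p p) := by
  exact ⟨⟨TwistedMod.bargmann_twPi hlam, TwistedMod.bargmann_twU hlam⟩,
    fun p q _ _ f hf =>
      ⟨TwistedMod.twTransD_mem_modSpace hlam hf, TwistedMod.twModD_mem_modSpace hlam hf⟩,
    TwistedMod.twUD_twPiD_twUadjD hlam,
    fun p _ f hf => TwistedMod.twUD_mem_modSpace hlam hf⟩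

theorem mainTheorem6 (n : ℕ) (lam : ℝ) (hlam : lam ≠ 0) :
    ((∀ (ξ η : TwistedMod.RR n) (g : 𝓢(TwistedMod.RR n, ℂ)),
        TwistedMod.bargmann lam (TwistedMod.twPi lam ξ η g)
          = TwistedMod.fockRep lam (TwistedMod.toCC ξ + Complex.I • TwistedMod.toCC η)
              (TwistedMod.bargmann lam g)) ∧
      (∀ (g : 𝓢(TwistedMod.RR n, ℂ)) (ζ : TwistedMod.CC n),
        TwistedMod.bargmann lam (TwistedMod.twU lam hlam g) ζ
          = TwistedMod.bargmann lam g (-(Complex.I • ζ)))) ∧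
    (∀ (p q : ℝ≥0∞), 1 ≤ p → 1 ≤ q → ∀ f ∈ TwistedMod.modSpace n lam p q,
      (∀ ξ : TwistedMod.RR n, TwistedMod.twTransD lam ξ f ∈ TwistedMod.modSpace n lam p q) ∧
      (∀ η : TwistedMod.RR n, TwistedMod.twModD lam η f ∈ TwistedMod.modSpace n lam p q)) ∧
    (∀ (ξ η : TwistedMod.RR n) (f : 𝓢'(TwistedMod.RR n, ℂ)),
      TwistedMod.twUD lam hlam (TwistedMod.twPiD lam ξ η (TwistedMod.twUadjD lam hlam f))
        = TwistedMod.twPiD lam (-η) ξ f) ∧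
    (∀ p : ℝ≥0∞, 1 ≤ p → ∀ f ∈ TwistedMod.modSpace n lam p p,
      TwistedMod.twUD lam hlam f ∈ TwistedMod.modSpace n lam p p) := by
  obtain ⟨bargmann, shifts, conjugation, rotation⟩ := mainTheorem6_general n lam hlam
  exact ⟨bargmann, fun p q hp hq => shifts p q (zero_lt_one.trans_le hp) (zero_lt_one.trans_le hq),
    conjugation, fun p hp => rotation p (zero_lt_one.trans_le hp)⟩
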